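/- Let $n\ge 2$. Consider a finite rooted tree whose $n$ leaves correspond one-to-one to the coordinates $x_1,\dots,x_n$ of $x\in\mathbb R^n$ and each of whose inner nodes $I$ has at least one child and carries an exponent $p_I\in(0,\infty)$. The associated $L_p$-nested function $f:\mathbb R^n\to[0,\infty)$ is the value of the root, where a leaf has the value $|x_i|$ and an inner node $I$ with children of values $v_{I,1},\dots,v_{I,\ell_I}$ has the value $v_I=\bigl(\sum_{j=1}^{\ell_I} v_{I,j}^{p_I}\bigr)^{1/p_I}$. For $\nu:\mathbb R^n\to[0,\infty)$ put $\mathcal S_\nu(1)=\frac{d}{dR}\big|_{R=1}\operatorname{vol}\{x:\nu(x)\le R\}$. A random vector in $\mathbb R^n$ is called $L_p$-nested symmetric with respect to $f$ if for some probability density $\varrho$ on $(0,\infty)$ it has the Lebesgue density $$\rho(x)=\frac{\varrho(f(x))}{f(x)^{n-1}\,\mathcal S_f(1)},$$ and $L_p$-spherically symmetric with exponent $p>0$ if it has a density of this form with $f$ replaced by $\|x\|_p=\bigl(\sum_i|x_i|^p\bigr)^{1/p}$. Let $X$ be an $L_p$-nested symmetric random vector with respect to $f$ whose coordinates $X_1,\dots,X_n$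 are independent. Then there is $p\in(0,\infty)$ such that the tree collapses to a single $L_p$-norm, that is, every inner node with at least two children has exponent $p_I=p$ and $f(x)=\|x\|_p$ for all $x\in\mathbb R^n$; and $X$ is $L_p$-spherically symmetric with this exponent $p$. In fact $X$ follows a $p$-generalized Normal distribution: for some $\tau>0$ it has the density $$\rho(x)=\frac{\exp(-\tau\|x\|_p^p)}{\int_{\mathbb R^n}\exp(-\tau\|y\|_p^p)\,dy}.$$ -/

import Mathlib

open MeasureTheory ProbabilityTheory
open scoped ENNReal

/-- The `L_p` norm `(∑ |x_i|^p)^(1/p)` of a real vector, for a real exponent `p > 0`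
(only a quasi-norm if `p < 1`). -/
noncomputable def lpNormFun {ι : Type*} [Fintype ι] (p : ℝ) (x : ι → ℝ) : ℝ :=
  (∑ i, |x i| ^ p) ^ (1 / p)

/-- Finite rooted ordered trees. A leaf carries the index of a coordinate, an inner node carries
a real exponent and the list of its direct children. -/
inductive LpTree (ι : Type) : Type
  | leaf (i : ι) : LpTree ι
  | node (p : ℝ) (l : ℕ) (child : Fin l → LpTree ι) : LpTree ι

namespace LpTree

variable {ι : Type}

/-- The cascade of `L_p` norms described by the tree: a leaf has the value `|x_i|`, and an inner
node has the `L_p` norm, with its own exponent, of the values of its direct children. -/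
noncomputable def nestedFun : LpTree ι → (ι → ℝ) → ℝ
  | leaf i, x => |x i|
  | node p _ child, x => lpNormFun p (fun j => (child j).nestedFun x)

/-- The coordinate indices at the leaves, with multiplicity. -/
def leaves : LpTree ι → Multiset ι
  | leaf i => {i}
  | node _ _ child => ∑ j, (child j).leaves

/-- Every inner node has a positive exponent and at least one child. -/
def NodesValid : LpTree ι → Prop
  | leaf _ => True
  | node p l child => 0 < p ∧ 1 ≤ l ∧ ∀ j, (child j).NodesValid

/-- The leaves correspond one-to-one to the coordinates, and all inner nodes are valid. -/
def IsLpNested [Fintype ι] (T : LpTree ι) : Prop :=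
  T.NodesValid ∧ T.leaves = (Finset.univ : Finset ι).val

/-- Every inner node with at least two children has the exponent `q`. (The exponent of an inner
node with a single child has no influence on the value of that node.) -/
def CollapsesTo (q : ℝ) : LpTree ι → Prop
  | leaf _ => True
  | node p l child => (2 ≤ l → p = q) ∧ ∀ j, (child j).CollapsesTo q

end LpTree

/-- The volume `𝒱_ν(R)` of `{x | ν x ≤ R}`. -/
noncomputable def ballVolume {n : ℕ} (ν : (Fin n → ℝ) → ℝ) (R : ℝ) : ℝ :=
  (volume : Measure (Fin n → ℝ)).real {x | ν x ≤ R}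

/-- The surface area `𝒮_ν(R)` of `{x | ν x = R}`: the derivative of the volume with respect to
the radius. -/
noncomputable def sphereSurface {n : ℕ} (ν : (Fin n → ℝ) → ℝ) (R : ℝ) : ℝ :=
  deriv (ballVolume ν) R

/-- `ϱ` is a probability density on the positive half-line. -/
def IsRadialDensity (ϱ : ℝ → ℝ) : Prop :=
  Measurable ϱ ∧ (∀ r, 0 ≤ ϱ r) ∧ ∫⁻ r in Set.Ioi (0 : ℝ), ENNReal.ofReal (ϱ r) = 1

/-- `μ` has the Lebesgue density `ϱ(ν x) / (ν(x)^(n-1) 𝒮_ν(1))` for some radial density `ϱ`. -/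
def IsSphericallySymmetric {n : ℕ} (ν : (Fin n → ℝ) → ℝ) (μ : Measure (Fin n → ℝ)) : Prop :=
  ∃ ϱ : ℝ → ℝ, IsRadialDensity ϱ ∧
    μ = volume.withDensity
      (fun x => ENNReal.ofReal (ϱ (ν x) / (ν x ^ (n - 1) * sphereSurface ν 1)))

/-- `μ` is `L_p`-nested symmetric with respect to the nested function of the tree `T`. -/
def IsLpNestedSymmetric {n : ℕ} (T : LpTree (Fin n)) (μ : Measure (Fin n → ℝ)) : Prop :=
  T.IsLpNested ∧ IsSphericallySymmetric T.nestedFun μ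

/-- `μ` is `L_p`-spherically symmetric with exponent `p`. -/
def IsLpSphericallySymmetric {n : ℕ} (p : ℝ) (μ : Measure (Fin n → ℝ)) : Prop :=
  0 < p ∧ IsSphericallySymmetric (lpNormFun p) μ

/-- `μ` is a `p`-generalized Normal distribution: for some `τ > 0` its Lebesgue density is
`exp (-τ ‖x‖_p^p)`, divided by its integral. -/
def IsPGeneralizedNormal {n : ℕ} (p : ℝ) (μ : Measure (Fin n → ℝ)) : Prop :=
  0 < p ∧ ∃ τ : ℝ, 0 < τ ∧
    μ = volume.withDensity (fun x => ENNReal.ofReal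
      (Real.exp (-τ * lpNormFun p x ^ p) /
        ∫ y : Fin n → ℝ, Real.exp (-τ * lpNormFun p y ^ p)))

/-! Independence makes the density a product, so `g (f x) = ∏ h i (x i)` almost everywhere, with `f`
the nested function and `g` the radial profile. If this held everywhere with a continuous profile
`G`, the rest would be short. On the plane of two coordinates, `f` is the `L_q` norm, with `q` the
exponent of the lowest common ancestor of the two leaves. Comparing factors gives `G ((x^q +
y^q)^(1/q)) * G 0 = G x * G y`, which is Cauchy's equation in the variable `r^q`, hence `G r = G 0 *
exp (-τ * r^q)`. Since `G` is the same for all pairs, so is `q`; and each node with two children is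
the lowest common ancestor of some pair.

The work lies in the regularity, since `g` is only measurable. Fix all coordinates except `i` and
`j` and integrate the identity over `x j` in a shell away from zero: the right side is a nonzero
constant times `h i`. The left side is continuous in `x i`, because `f` expands distances in `x j`
there, so substitution bounds the integral by an `L¹` norm of `g`, locally uniformly in `x i`, and
`g` can be replaced by a continuous function (`continuous_setIntegral_absIcc_comp`). So each `h i`
has a continuous version, and homogeneity of `f` turns the almost everywhere identity into one valid
everywhere (`exists_continuous_comp_of_ae_eq_comp`). -/

namespace LpTree

/-! ### Elementary properties of nested functions -/

variable {ι : Type}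

theorem nestedFun_nonneg (T : LpTree ι) (x : ι → ℝ) : 0 ≤ T.nestedFun x := by
  cases T with
  | leaf i => exact abs_nonneg _
  | node p l child =>
    exact Real.rpow_nonneg (Finset.sum_nonneg fun j _ => Real.rpow_nonneg (abs_nonneg _) _) _

theorem nestedFun_node (p : ℝ) (l : ℕ) (child : Fin l → LpTree ι) (x : ι → ℝ) :
    (node p l child).nestedFun x = (∑ j, (child j).nestedFun x ^ p) ^ (1 / p) := by
  simp only [nestedFun, lpNormFun]
  congr 1
  exact Finset.sum_congr rfl fun j _ => by rw [abs_of_nonneg (nestedFun_nonneg _ _)]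

theorem mem_leaves_node {p : ℝ} {l : ℕ} {child : Fin l → LpTree ι} {i : ι} :
    i ∈ (node p l child).leaves ↔ ∃ j, i ∈ (child j).leaves := by
  simp [leaves, Multiset.mem_sum]

theorem nestedFun_congr (T : LpTree ι) {x y : ι → ℝ} (h : ∀ i ∈ T.leaves, |x i| = |y i|) :
    T.nestedFun x = T.nestedFun y := by
  induction T with
  | leaf i => exact h i (by simp [leaves])
  | node p l child ih =>
    rw [nestedFun_node, nestedFun_node]
    congr 1
    exact Finset.sum_congr rfl fun j _ => by
      rw [ih j fun i hi => h i (mem_leaves_node.2 ⟨j, hi⟩)]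

theorem NodesValid.continuous_nestedFun {T : LpTree ι} (hT : T.NodesValid) :
    Continuous T.nestedFun := by
  induction T with
  | leaf i => exact (continuous_apply i).abs
  | node p l child ih =>
    obtain ⟨hp, -, hc⟩ := hT
    have : (node p l child).nestedFun = fun x => (∑ j, (child j).nestedFun x ^ p) ^ (1 / p) :=
      funext fun x => nestedFun_node _ _ _ _
    rw [this]
    refine Continuous.rpow_const (continuous_finsetSum _ fun j _ =>
      (ih j (hc j)).rpow_const fun _ => Or.inr hp.le) fun _ => Or.inr (by positivity)

theorem NodesValid.nestedFun_smul {T : LpTree ι} (hT : T.NodesValid) (r : ℝ) (x : ι → ℝ) :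
    T.nestedFun (r • x) = |r| * T.nestedFun x := by
  induction T with
  | leaf i => simp [nestedFun, abs_mul]
  | node p l child ih =>
    obtain ⟨hp, -, hc⟩ := hT
    rw [nestedFun_node, nestedFun_node]
    have : ∀ j, (child j).nestedFun (r • x) ^ p = |r| ^ p * (child j).nestedFun x ^ p := by
      intro j
      rw [ih j (hc j), Real.mul_rpow (abs_nonneg _) (nestedFun_nonneg _ _)]
    simp_rw [this]
    rw [← Finset.mul_sum, Real.mul_rpow (by positivity)
      (Finset.sum_nonneg fun j _ => Real.rpow_nonneg (nestedFun_nonneg _ _) _), one_div,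
      Real.rpow_rpow_inv (abs_nonneg _) hp.ne']

theorem NodesValid.abs_le_nestedFun {T : LpTree ι} (hT : T.NodesValid) (x : ι → ℝ) {i : ι}
    (hi : i ∈ T.leaves) : |x i| ≤ T.nestedFun x := by
  induction T with
  | leaf k =>
    have : i = k := by simpa [leaves] using hi
    simp [nestedFun, this]
  | node p l child ih =>
    obtain ⟨hp, -, hc⟩ := hT
    obtain ⟨j, hj⟩ := mem_leaves_node.1 hi
    rw [nestedFun_node]
    refine (ih j (hc j) hj).trans ?_
    calc (child j).nestedFun x = ((child j).nestedFun x ^ p) ^ (1 / p) := by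
          rw [one_div, Real.rpow_rpow_inv (nestedFun_nonneg _ _) hp.ne']
      _ ≤ _ := Real.rpow_le_rpow (Real.rpow_nonneg (nestedFun_nonneg _ _) _)
          (Finset.single_le_sum (f := fun j => (child j).nestedFun x ^ p)
            (fun k _ => Real.rpow_nonneg (nestedFun_nonneg _ _) _) (Finset.mem_univ j))
          (by positivity)

theorem NodesValid.nestedFun_eq_zero {T : LpTree ι} (hT : T.NodesValid) {x : ι → ℝ}
    (h : ∀ i ∈ T.leaves, x i = 0) : T.nestedFun x = 0 := by
  have := hT.nestedFun_smul 0 x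
  rw [abs_zero, zero_mul] at this
  rw [← this]
  exact nestedFun_congr T fun i hi => by simp [h i hi]

theorem NodesValid.exists_mem_leaves {T : LpTree ι} (hT : T.NodesValid) : ∃ i, i ∈ T.leaves := by
  induction T with
  | leaf i => exact ⟨i, by simp [leaves]⟩
  | node p l child ih =>
    obtain ⟨-, hl, hc⟩ := hT
    obtain ⟨i, hi⟩ := ih ⟨0, hl⟩ (hc _)
    exact ⟨i, mem_leaves_node.2 ⟨_, hi⟩⟩

theorem nodup_child {p : ℝ} {l : ℕ} {child : Fin l → LpTree ι}
    (h : (node p l child).leaves.Nodup) (j : Fin l) : (child j).leaves.Nodup :=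
  Multiset.nodup_of_le
    (Finset.single_le_sum (f := fun j => (child j).leaves) (fun _ _ => Multiset.zero_le _)
      (Finset.mem_univ j)) h

theorem notMem_leaves_of_ne {p : ℝ} {l : ℕ} {child : Fin l → LpTree ι}
    (h : (node p l child).leaves.Nodup) {j k : Fin l} (hjk : k ≠ j) {i : ι}
    (hi : i ∈ (child j).leaves) : i ∉ (child k).leaves := by
  classical
  intro hk
  have h1 := Multiset.nodup_iff_count_le_one.1 h i
  rw [leaves, Multiset.count_sum'] at h1
  have h2 := Finset.add_le_sum (f := fun j => (child j).leaves.count i) (s := Finset.univ)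
    (fun _ _ => Nat.zero_le _) (Finset.mem_univ j) (Finset.mem_univ k) hjk.symm
  have h3 := Multiset.one_le_count_iff_mem.2 hi
  have h4 := Multiset.one_le_count_iff_mem.2 hk
  omega

/-- If all leaves with a nonzero coordinate lie below one child, the other children do not
contribute to the value of the node. -/
theorem NodesValid.nestedFun_node_eq_child {p : ℝ} {l : ℕ} {child : Fin l → LpTree ι}
    (hT : (node p l child).NodesValid) {x : ι → ℝ} {j : Fin l}
    (h : ∀ k ≠ j, ∀ i ∈ (child k).leaves, x i = 0) :
    (node p l child).nestedFun x = (child j).nestedFun x := by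
  obtain ⟨hp, -, hc⟩ := hT
  rw [nestedFun_node, Finset.sum_eq_single j, one_div,
    Real.rpow_rpow_inv (nestedFun_nonneg _ _) hp.ne']
  · intro k _ hk
    rw [(hc k).nestedFun_eq_zero (h k hk), Real.zero_rpow hp.ne']
  · simp

theorem NodesValid.nestedFun_eq_abs {T : LpTree ι} (hT : T.NodesValid)
    (hd : T.leaves.Nodup) {x : ι → ℝ} {i : ι} (hi : i ∈ T.leaves)
    (h : ∀ k ∈ T.leaves, k ≠ i → x k = 0) : T.nestedFun x = |x i| := by
  induction T with
  | leaf k =>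
    have : i = k := by simpa [leaves] using hi
    simp [nestedFun, this]
  | node p l child ih =>
    obtain ⟨j, hj⟩ := mem_leaves_node.1 hi
    rw [hT.nestedFun_node_eq_child (j := j)]
    · exact ih j (hT.2.2 j) (nodup_child hd j) hj fun k hk =>
        h k (mem_leaves_node.2 ⟨j, hk⟩)
    · intro k hk m hm
      refine h m (mem_leaves_node.2 ⟨k, hm⟩) ?_
      rintro rfl
      exact notMem_leaves_of_ne hd hk hj hm

/-! ### Exponents on coordinate planes and collapse of the tree -/

/-- On the plane of the coordinates `i` and `k` the nested function is the `L_q` norm. -/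
def PairExponent (T : LpTree ι) (i k : ι) (q : ℝ) : Prop :=
  ∀ x : ι → ℝ, (∀ m, m ≠ i → m ≠ k → x m = 0) →
    T.nestedFun x = (|x i| ^ q + |x k| ^ q) ^ (1 / q)

theorem NodesValid.pairExponent_child {p : ℝ} {l : ℕ} {child : Fin l → LpTree ι}
    (hT : (node p l child).NodesValid) (hd : (node p l child).leaves.Nodup) {j : Fin l} {i k : ι}
    (hi : i ∈ (child j).leaves) (hk : k ∈ (child j).leaves) {q : ℝ}
    (h : (child j).PairExponent i k q) : (node p l child).PairExponent i k q := by
  intro x hx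
  rw [← h x hx]
  refine hT.nestedFun_node_eq_child fun j' hj' m hm => hx m ?_ ?_
  · rintro rfl; exact notMem_leaves_of_ne hd hj' hi hm
  · rintro rfl; exact notMem_leaves_of_ne hd hj' hk hm

/-- The node is the lowest common ancestor of the two leaves: each of the two children sees one
nonzero coordinate at most, the other children none. -/
theorem NodesValid.pairExponent_node {p : ℝ} {l : ℕ} {child : Fin l → LpTree ι}
    (hT : (node p l child).NodesValid) (hd : (node p l child).leaves.Nodup) {j j' : Fin l}
    (hj : j ≠ j') {i k : ι} (hi : i ∈ (child j).leaves) (hk : k ∈ (child j').leaves) :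
    (node p l child).PairExponent i k p := by
  intro x hx
  rw [nestedFun_node]
  congr 1
  rw [Fintype.sum_eq_add j j' hj]
  · rw [(hT.2.2 j).nestedFun_eq_abs (nodup_child hd j) hi,
      (hT.2.2 j').nestedFun_eq_abs (nodup_child hd j') hk]
    · intro m hm hmk
      refine hx m ?_ hmk
      rintro rfl; exact notMem_leaves_of_ne hd hj.symm hi hm
    · intro m hm hmi
      refine hx m hmi ?_
      rintro rfl; exact notMem_leaves_of_ne hd hj hk hm
  · rintro m ⟨hm, hm'⟩
    rw [(hT.2.2 m).nestedFun_eq_zero, Real.zero_rpow hT.1.ne']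
    intro t ht
    refine hx t ?_ ?_
    · rintro rfl; exact notMem_leaves_of_ne hd hm hi ht
    · rintro rfl; exact notMem_leaves_of_ne hd hm' hk ht

theorem NodesValid.exists_pairExponent {T : LpTree ι} (hT : T.NodesValid) (hd : T.leaves.Nodup)
    {i k : ι} (hik : i ≠ k) (hi : i ∈ T.leaves) (hk : k ∈ T.leaves) :
    ∃ q, 0 < q ∧ T.PairExponent i k q := by
  induction T with
  | leaf m =>
    simp only [leaves, Multiset.mem_singleton] at hi hk
    exact absurd (hi.trans hk.symm) hik
  | node p l child ih =>
    obtain ⟨j, hj⟩ := mem_leaves_node.1 hi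
    obtain ⟨j', hj'⟩ := mem_leaves_node.1 hk
    by_cases h : j = j'
    · subst h
      obtain ⟨q, hq, h⟩ := ih j (hT.2.2 j) (nodup_child hd j) hj hj'
      exact ⟨q, hq, hT.pairExponent_child hd hj hj' h⟩
    · exact ⟨p, hT.1, hT.pairExponent_node hd h hj hj'⟩

/-- A node with two children is the lowest common ancestor of a leaf below the first and a leaf
below the second, so its exponent is a pair exponent. -/
theorem NodesValid.collapsesTo {T : LpTree ι} (hT : T.NodesValid) (hd : T.leaves.Nodup) {p : ℝ}
    (h : ∀ i ∈ T.leaves, ∀ k ∈ T.leaves, i ≠ k → ∀ q, 0 < q → T.PairExponent i k q → q = p) :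
    T.CollapsesTo p := by
  induction T with
  | leaf m => trivial
  | node p' l child ih =>
    refine ⟨fun hl => ?_, fun j => ih j (hT.2.2 j) (nodup_child hd j) ?_⟩
    · have hne : (⟨0, by omega⟩ : Fin l) ≠ ⟨1, by omega⟩ := by simp
      obtain ⟨i, hi⟩ := (hT.2.2 ⟨0, by omega⟩).exists_mem_leaves
      obtain ⟨k, hk⟩ := (hT.2.2 ⟨1, by omega⟩).exists_mem_leaves
      refine h i (mem_leaves_node.2 ⟨_, hi⟩) k (mem_leaves_node.2 ⟨_, hk⟩) ?_ p' hT.1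
        (hT.pairExponent_node hd hne hi hk)
      rintro rfl
      exact notMem_leaves_of_ne hd hne hk hi
    · intro i hi k hk hik q hq hp
      exact h i (mem_leaves_node.2 ⟨j, hi⟩) k (mem_leaves_node.2 ⟨j, hk⟩) hik q hq
        (hT.pairExponent_child hd hi hk hp)

theorem NodesValid.nestedFun_eq_of_collapsesTo {T : LpTree ι} (hT : T.NodesValid) {p : ℝ}
    (hp : 0 < p) (h : T.CollapsesTo p) (x : ι → ℝ) :
    T.nestedFun x = (T.leaves.map fun i => |x i| ^ p).sum ^ (1 / p) := by
  induction T with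
  | leaf i => simp [nestedFun, leaves, Real.rpow_rpow_inv (abs_nonneg _) hp.ne']
  | node p' l child ih =>
    have key : ∀ j, (child j).nestedFun x ^ p = ((child j).leaves.map fun i => |x i| ^ p).sum := by
      intro j
      rw [ih j (hT.2.2 j) (h.2 j), one_div, Real.rpow_inv_rpow _ hp.ne']
      refine Multiset.sum_nonneg fun y hy => ?_
      obtain ⟨i, -, rfl⟩ := Multiset.mem_map.1 hy
      positivity
    have hsum : ((node p' l child).leaves.map fun i => |x i| ^ p).sum
        = ∑ j, (child j).nestedFun x ^ p := by
      simp_rw [key, leaves]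
      exact map_sum ((Multiset.sumAddMonoidHom (M := ℝ)).comp
        (Multiset.mapAddMonoidHom fun i => |x i| ^ p)) (fun j => (child j).leaves) Finset.univ
    rw [hsum]
    rcases (show l = 1 ∨ 2 ≤ l by have := hT.2.1; omega) with rfl | hl
    · rw [hT.nestedFun_node_eq_child (j := 0) (fun k hk => absurd (Subsingleton.elim k 0) hk)]
      simp [Real.rpow_rpow_inv (nestedFun_nonneg _ _) hp.ne']
    · rw [nestedFun_node, h.1 hl]

end LpTree

/-! ### Expansion in one coordinate -/

/-- Mean value inequality: the derivative `q * x ^ (q - 1)` is monotone or antitone, so its minimum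
on `[a, b]` is at an endpoint. -/
theorem exists_mul_sub_le_rpow_sub_rpow {a q : ℝ} (b : ℝ) (ha : 0 < a) (hq : 0 < q) :
    ∃ c, 0 < c ∧ ∀ u v, a ≤ u → u ≤ v → v ≤ b → c * (v - u) ≤ v ^ q - u ^ q := by
  by_cases hab : a ≤ b
  swap
  · exact ⟨1, one_pos, fun u v h1 h2 h3 => absurd (h1.trans (h2.trans h3)) hab⟩
  have hb : 0 < b := ha.trans_le hab
  refine ⟨q * min (a ^ (q - 1)) (b ^ (q - 1)),
    mul_pos hq (lt_min (Real.rpow_pos_of_pos ha _) (Real.rpow_pos_of_pos hb _)), ?_⟩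
  intro u v hu huv hv
  have hpos : ∀ x ∈ Set.Icc a b, x ≠ 0 := fun x hx => (ha.trans_le hx.1).ne'
  refine (convex_Icc a b).mul_sub_le_image_sub_of_le_deriv (f := fun x : ℝ => x ^ q)
    (Real.continuous_rpow_const hq.le).continuousOn ?_ ?_ u ⟨hu, huv.trans hv⟩ v
    ⟨hu.trans huv, hv⟩ huv
  · intro x hx
    exact (Real.differentiableAt_rpow_const_of_ne q
      (hpos x (interior_subset hx))).differentiableWithinAt
  · intro x hx
    have hx' := interior_subset hx
    have hx0 := ha.trans_le hx'.1
    rw [Real.deriv_rpow_const]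
    refine mul_le_mul_of_nonneg_left ?_ hq.le
    rcases le_total 1 q with h | h
    · exact (min_le_left _ _).trans (Real.rpow_le_rpow ha.le hx'.1 (by linarith))
    · exact (min_le_right _ _).trans
        (Real.rpow_le_rpow_of_nonpos hx0 hx'.2 (by linarith))

namespace LpTree

variable {ι : Type}

theorem NodesValid.exists_nestedFun_le {T : LpTree ι} (hT : T.NodesValid) (b : ℝ) :
    ∃ M, ∀ x : ι → ℝ, (∀ k, |x k| ≤ b) → T.nestedFun x ≤ M := by
  have hK : IsCompact (Set.univ.pi fun _ : ι => Set.Icc (-b) b) :=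
    isCompact_univ_pi fun _ => isCompact_Icc
  obtain ⟨M, hM⟩ := hK.bddAbove_image hT.continuous_nestedFun.continuousOn
  exact ⟨M, fun x hx => hM ⟨x, fun k _ => abs_le.1 (hx k), rfl⟩⟩

/-- Along coordinate `i`, the `p`-th power of a node changes only through the child containing `i`.
Both power maps expand on the relevant intervals, which are bounded below through `|x i|` and above
by compactness. The constant is uniform over the cube. -/
theorem NodesValid.exists_mul_sub_le_nestedFun_sub [DecidableEq ι] {T : LpTree ι}
    (hT : T.NodesValid) (hd : T.leaves.Nodup) {i : ι} (hi : i ∈ T.leaves) {a : ℝ} (ha : 0 < a)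
    (b : ℝ) :
    ∃ c, 0 < c ∧ ∀ x : ι → ℝ, (∀ k, |x k| ≤ b) → ∀ u v, a ≤ u → u ≤ v → v ≤ b →
      c * (v - u) ≤ T.nestedFun (Function.update x i v) - T.nestedFun (Function.update x i u) := by
  induction T with
  | leaf k =>
    obtain rfl : i = k := by simpa [leaves] using hi
    refine ⟨1, one_pos, fun x _ u v hu huv _ => ?_⟩
    simp [nestedFun, abs_of_nonneg (ha.le.trans hu), abs_of_nonneg (ha.le.trans (hu.trans huv))]
  | node p l child ih =>
    have hval := hT
    obtain ⟨hp, -, hc⟩ := hT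
    obtain ⟨j, hj⟩ := mem_leaves_node.1 hi
    obtain ⟨c₀, hc₀, h₀⟩ := ih j (hc j) (nodup_child hd j) hj
    obtain ⟨M, hM⟩ := (hc j).exists_nestedFun_le b
    obtain ⟨N, hN⟩ := hval.exists_nestedFun_le b
    obtain ⟨c₁, hc₁, h₁⟩ := exists_mul_sub_le_rpow_sub_rpow M ha hp
    obtain ⟨c₂, hc₂, h₂⟩ := exists_mul_sub_le_rpow_sub_rpow (N ^ p) (Real.rpow_pos_of_pos ha p)
      (q := 1 / p) (by positivity)
    refine ⟨c₂ * (c₁ * c₀), by positivity, fun x hx u v hu huv hv => ?_⟩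
    have hcube : ∀ w, a ≤ w → w ≤ b → ∀ k, |Function.update x i w k| ≤ b := by
      intro w hw hwb k
      by_cases hk : k = i
      · subst hk; simpa [abs_of_nonneg (ha.le.trans hw)] using hwb
      · simpa [hk] using hx k
    have hle : ∀ w, a ≤ w → a ≤ (child j).nestedFun (Function.update x i w) := by
      intro w hw
      have := (hc j).abs_le_nestedFun (Function.update x i w) hj
      rw [Function.update_self, abs_of_nonneg (ha.le.trans hw)] at this
      exact hw.trans this
    have hle' : ∀ w, a ≤ w → a ≤ (node p l child).nestedFun (Function.update x i w) := by
      intro w hw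
      have := hval.abs_le_nestedFun (Function.update x i w) hi
      rw [Function.update_self, abs_of_nonneg (ha.le.trans hw)] at this
      exact hw.trans this
    have hroot : ∀ w, (node p l child).nestedFun (Function.update x i w) ^ p
        = ∑ k, (child k).nestedFun (Function.update x i w) ^ p := by
      intro w
      rw [nestedFun_node, one_div, Real.rpow_inv_rpow _ hp.ne']
      exact Finset.sum_nonneg fun k _ => Real.rpow_nonneg (nestedFun_nonneg _ _) _
    have hinv : ∀ w, ((node p l child).nestedFun (Function.update x i w) ^ p) ^ (1 / p)
        = (node p l child).nestedFun (Function.update x i w) := fun w => by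
      rw [one_div, Real.rpow_rpow_inv (nestedFun_nonneg _ _) hp.ne']
    have hua := hu.trans huv
    have hub := huv.trans hv
    have key₀ := h₀ x hx u v hu huv hv
    have key₁ := h₁ _ _ (hle u hu) (by nlinarith [mul_nonneg hc₀.le (sub_nonneg.2 huv)])
      (hM _ (hcube v hua hv))
    have hdiff : (node p l child).nestedFun (Function.update x i v) ^ p
        - (node p l child).nestedFun (Function.update x i u) ^ p
        = (child j).nestedFun (Function.update x i v) ^ p
          - (child j).nestedFun (Function.update x i u) ^ p := by
      rw [hroot, hroot, ← Finset.sum_sub_distrib]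
      refine Finset.sum_eq_single j (fun k _ hk => ?_) (by simp)
      rw [nestedFun_congr (child k) (x := Function.update x i v) (y := Function.update x i u),
        sub_self]
      intro m hm
      have : m ≠ i := by rintro rfl; exact notMem_leaves_of_ne hd hk hj hm
      simp [this]
    have hc₁₀ : c₁ * (c₀ * (v - u)) ≤ (node p l child).nestedFun (Function.update x i v) ^ p
        - (node p l child).nestedFun (Function.update x i u) ^ p := by
      rw [hdiff]
      exact (mul_le_mul_of_nonneg_left key₀ hc₁.le).trans key₁
    have hpos : 0 ≤ c₁ * (c₀ * (v - u)) := by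
      have := sub_nonneg.2 huv
      positivity
    have key₂ := h₂ _ _ (Real.rpow_le_rpow ha.le (hle' u hu) hp.le) (by linarith)
      (Real.rpow_le_rpow (nestedFun_nonneg _ _) (hN _ (hcube v hua hv)) hp.le)
    rw [hinv, hinv] at key₂
    refine le_trans ?_ key₂
    calc c₂ * (c₁ * c₀) * (v - u) = c₂ * (c₁ * (c₀ * (v - u))) := by ring
      _ ≤ _ := mul_le_mul_of_nonneg_left hc₁₀ hc₂.le

end LpTree

/-! ### Substitution bounds and continuity of parametric integrals -/

/-- The inverse of `F` on its image is `c⁻¹`-Lipschitz, so `F` pushes Lebesgue measure to at most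
`c⁻¹` times Lebesgue measure. No differentiability is needed. -/
theorem lintegral_comp_le_of_expanding {F : ℝ → ℝ} {a b a' M c : ℝ} (hF : Measurable F)
    (hc : 0 < c) (h : ∀ u v, a ≤ u → u ≤ v → v ≤ b → c * (v - u) ≤ F v - F u)
    (hmaps : ∀ u ∈ Set.Icc a b, F u ∈ Set.Icc a' M) {G : ℝ → ℝ≥0∞} (hG : Measurable G) :
    ∫⁻ u in Set.Icc a b, G (F u) ≤ ENNReal.ofReal c⁻¹ * ∫⁻ r in Set.Icc a' M, G r := by
  have habs : ∀ u ∈ Set.Icc a b, ∀ v ∈ Set.Icc a b, |u - v| ≤ c⁻¹ * |F u - F v| := by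
    intro u hu v hv
    rw [inv_mul_eq_div, le_div_iff₀ hc]
    rcases le_total u v with huv | huv
    · have := h u v hu.1 huv hv.2
      rw [abs_sub_comm u v, abs_sub_comm (F u), abs_of_nonneg (sub_nonneg.2 huv)]
      linarith [le_abs_self (F v - F u)]
    · have := h v u hv.1 huv hu.2
      rw [abs_of_nonneg (sub_nonneg.2 huv)]
      linarith [le_abs_self (F u - F v)]
  have hinj : Set.InjOn F (Set.Icc a b) := by
    intro u hu v hv huv
    have := habs u hu v hv
    rw [huv, sub_self, abs_zero, mul_zero] at this
    exact sub_eq_zero.1 (abs_nonpos_iff.1 this)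
  have hle : (volume.restrict (Set.Icc a b)).map F
      ≤ ENNReal.ofReal c⁻¹ • volume.restrict (Set.Icc a' M) := by
    refine Measure.le_iff.2 fun E hE => ?_
    rw [Measure.map_apply hF hE, Measure.restrict_apply (hF hE), Measure.smul_apply,
      Measure.restrict_apply hE, smul_eq_mul]
    set A := F ⁻¹' E ∩ Set.Icc a b
    have hA : A ⊆ Set.Icc a b := Set.inter_subset_right
    have himg : Function.invFunOn F (Set.Icc a b) '' (F '' A) = A := by
      rw [Set.image_image]
      refine (Set.image_congr fun u hu => ?_).trans (Set.image_id A)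
      exact hinj.leftInvOn_invFunOn (hA hu)
    have hlip : LipschitzOnWith (Real.toNNReal c⁻¹) (Function.invFunOn F (Set.Icc a b))
        (F '' A) := by
      refine LipschitzOnWith.of_dist_le_mul ?_
      rintro _ ⟨u, hu, rfl⟩ _ ⟨v, hv, rfl⟩
      rw [hinj.leftInvOn_invFunOn (hA hu), hinj.leftInvOn_invFunOn (hA hv),
        Real.coe_toNNReal _ (inv_nonneg.2 hc.le), Real.dist_eq, Real.dist_eq]
      exact habs u (hA hu) v (hA hv)
    -- One-dimensional Hausdorff measure is Lebesgue measure on the line.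
    have := hlip.hausdorffMeasure_image_le zero_le_one
    rw [himg, hausdorffMeasure_real, ENNReal.rpow_one] at this
    refine this.trans (mul_le_mul' le_rfl (measure_mono ?_))
    rintro _ ⟨u, hu, rfl⟩
    exact ⟨hu.1, hmaps u hu.2⟩
  calc ∫⁻ u in Set.Icc a b, G (F u) = ∫⁻ r, G r ∂((volume.restrict (Set.Icc a b)).map F) :=
        (lintegral_map hG hF).symm
    _ ≤ ∫⁻ r, G r ∂(ENNReal.ofReal c⁻¹ • volume.restrict (Set.Icc a' M)) := lintegral_mono' hle le_rfl
    _ = _ := by rw [lintegral_smul_measure, smul_eq_mul]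

/-- The symmetric shell `a ≤ |u| ≤ b` on the real line. -/
def absIcc (a b : ℝ) : Set ℝ := {u | |u| ∈ Set.Icc a b}

theorem measurableSet_absIcc (a b : ℝ) : MeasurableSet (absIcc a b) :=
  measurableSet_Icc.preimage continuous_abs.measurable

theorem isCompact_absIcc (a b : ℝ) : IsCompact (absIcc a b) :=
  isCompact_Icc.of_isClosed_subset (isClosed_Icc.preimage continuous_abs)
    (fun _ hu => abs_le.1 hu.2 : absIcc a b ⊆ Set.Icc (-b) b)

theorem lintegral_absIcc_comp_le_of_expanding {F : ℝ → ℝ} {a b a' M c : ℝ} (hF : Measurable F)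
    (heven : ∀ u, F (-u) = F u)
    (hc : 0 < c) (h : ∀ u v, a ≤ u → u ≤ v → v ≤ b → c * (v - u) ≤ F v - F u)
    (hmaps : ∀ u ∈ Set.Icc a b, F u ∈ Set.Icc a' M) {G : ℝ → ℝ≥0∞} (hG : Measurable G) :
    ∫⁻ u in absIcc a b, G (F u) ≤ ENNReal.ofReal (2 * c⁻¹) * ∫⁻ r in Set.Icc a' M, G r := by
  have hsub : absIcc a b ⊆ Set.Icc a b ∪ Neg.neg ⁻¹' Set.Icc a b := by
    intro u hu
    rcases abs_choice u with h | h
    · exact Or.inl (h ▸ hu)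
    · exact Or.inr (by have hu' : |u| ∈ Set.Icc a b := hu; rwa [h] at hu')
  have hneg : ∫⁻ u in Neg.neg ⁻¹' Set.Icc a b, G (F u) = ∫⁻ u in Set.Icc a b, G (F u) := by
    have := (Measure.measurePreserving_neg (volume : Measure ℝ)).setLIntegral_comp_preimage
      (measurableSet_Icc (a := a) (b := b)) (hG.comp hF)
    simpa only [Function.comp_apply, heven] using this
  have key := lintegral_comp_le_of_expanding hF hc h hmaps hG
  calc ∫⁻ u in absIcc a b, G (F u)
      ≤ ∫⁻ u in Set.Icc a b ∪ Neg.neg ⁻¹' Set.Icc a b, G (F u) := lintegral_mono_set hsub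
    _ ≤ _ := lintegral_union_le _ _ _
    _ ≤ _ := by
      rw [hneg, ENNReal.ofReal_mul zero_le_two, ENNReal.ofReal_ofNat, mul_assoc, two_mul]
      exact add_le_add key key

/-- For continuous `g` this is standard. In general `g` is approximated in `L¹` by a continuous `φ`,
and the substitution bound makes the error small uniformly for `|s| ≤ B`. -/
theorem continuous_setIntegral_absIcc_comp {F : ℝ → ℝ → ℝ} {a b : ℝ} {g : ℝ → ℝ}
    (hF : Continuous (Function.uncurry F)) (heven : ∀ s u, F s (-u) = F s u)
    (hlow : ∀ s, ∀ u ∈ Set.Icc a b, a ≤ F s u)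
    (h : ∀ B, ∃ c, 0 < c ∧ ∀ s, |s| ≤ B → ∀ u v, a ≤ u → u ≤ v → v ≤ b →
      c * (v - u) ≤ F s v - F s u)
    (hg : Measurable g) (hgi : ∀ M, IntegrableOn g (Set.Icc a M)) :
    Continuous fun s => ∫ u in absIcc a b, g (F s u) := by
  suffices hB : ∀ B, ContinuousOn (fun s => ∫ u in absIcc a b, g (F s u)) (Set.Icc (-B) B) by
    refine continuous_iff_continuousAt.2 fun s => (hB (|s| + 1)).continuousAt ?_
    refine Icc_mem_nhds ?_ ?_
    · linarith [neg_abs_le s]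
    · linarith [le_abs_self s]
  intro B
  obtain ⟨c, hc, hexp⟩ := h B
  obtain ⟨M, hM⟩ := ((isCompact_Icc (a := -B) (b := B)).prod (isCompact_Icc (a := a) (b := b))
    ).bddAbove_image hF.continuousOn
  have hFs : ∀ s, Continuous (F s) := fun s => hF.comp (Continuous.prodMk_right s)
  have hmaps : ∀ s ∈ Set.Icc (-B) B, ∀ u ∈ Set.Icc a b, F s u ∈ Set.Icc a M := fun s hs u hu =>
    ⟨hlow s u hu, hM ⟨(s, u), ⟨hs, hu⟩, rfl⟩⟩
  have hbound : ∀ s ∈ Set.Icc (-B) B, ∀ G : ℝ → ℝ≥0∞, Measurable G →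
      ∫⁻ u in absIcc a b, G (F s u) ≤ ENNReal.ofReal (2 * c⁻¹) * ∫⁻ r in Set.Icc a M, G r :=
    fun s hs G hG => lintegral_absIcc_comp_le_of_expanding (hFs s).measurable (heven s) hc
      (hexp s (abs_le.2 hs)) (hmaps s hs) hG
  have hint : ∀ s ∈ Set.Icc (-B) B, IntegrableOn (fun u => g (F s u)) (absIcc a b) := by
    intro s hs
    refine ⟨(hg.comp (hFs s).measurable).aestronglyMeasurable, ?_⟩
    refine (hbound s hs (fun r => ‖g r‖ₑ) hg.enorm).trans_lt ?_
    exact ENNReal.mul_lt_top ENNReal.ofReal_lt_top (hgi M).2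
  refine continuousOn_of_uniform_approx_of_continuousOn fun V hV => ?_
  obtain ⟨ε, hε, hεV⟩ := Metric.mem_uniformity_dist.1 hV
  -- The factor `c / 2` cancels the constant `2 * c⁻¹` of the substitution bound, whose `2` counts
  -- the two halves of the shell.
  have hδ : 0 < ε / 2 * (c / 2) := by positivity
  obtain ⟨φ, -, hφ, hφc, hφi⟩ := (hgi M).exists_hasCompactSupport_lintegral_sub_le
    (ε := ENNReal.ofReal (ε / 2 * (c / 2))) (by simpa using hδ)
  have hφint : ∀ s, IntegrableOn (fun u => φ (F s u)) (absIcc a b) := fun s =>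
    (hφc.comp (hFs s)).continuousOn.integrableOn_compact (isCompact_absIcc a b)
  refine ⟨fun s => ∫ u in absIcc a b, φ (F s u), ?_, fun s hs => hεV ?_⟩
  · exact (continuous_parametric_integral_of_continuous (f := fun s u => φ (F s u)) (hφc.comp hF)
      (isCompact_absIcc a b)).continuousOn
  · rw [dist_eq_norm, ← integral_sub (hint s hs) (hφint s)]
    have h1 : ‖∫ u in absIcc a b, (g (F s u) - φ (F s u))‖ₑ ≤ ENNReal.ofReal (ε / 2) := by
      calc _ ≤ ∫⁻ u in absIcc a b, ‖g (F s u) - φ (F s u)‖ₑ := enorm_integral_le_lintegral_enorm _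
        _ ≤ ENNReal.ofReal (2 * c⁻¹) * ∫⁻ r in Set.Icc a M, ‖g r - φ r‖ₑ :=
          hbound s hs (fun r => ‖g r - φ r‖ₑ) (hg.sub hφc.measurable).enorm
        _ ≤ ENNReal.ofReal (2 * c⁻¹) * ENNReal.ofReal (ε / 2 * (c / 2)) := mul_le_mul' le_rfl hφ
        _ = ENNReal.ofReal (ε / 2) := by
          rw [← ENNReal.ofReal_mul (by positivity)]
          congr 1
          field_simp
    rw [← ofReal_norm, ENNReal.ofReal_le_ofReal_iff (by positivity)] at h1
    linarith

/-! ### Product densities -/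

theorem lintegral_prod_eval_eq_prod_lintegral {n : ℕ} {h : Fin n → ℝ → ℝ≥0∞}
    (hm : ∀ i, Measurable (h i)) :
    ∫⁻ x : Fin n → ℝ, ∏ i, h i (x i) = ∏ i, ∫⁻ t, h i t := by
  induction n with
  | zero => simp [volume_pi]
  | succ n ih =>
    rw [← (volume_preserving_piFinSuccAbove (fun _ : Fin (n + 1) => ℝ) 0).symm.lintegral_comp
      (f := fun x : Fin (n + 1) → ℝ => ∏ i, h i (x i)) (Finset.measurable_prod _ fun i _ => (hm i).comp (measurable_pi_apply i))]
    have : ∀ z : ℝ × (Fin n → ℝ),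
        ∏ i, h i ((MeasurableEquiv.piFinSuccAbove (fun _ : Fin (n + 1) => ℝ) 0).symm z i)
          = h 0 z.1 * ∏ i : Fin n, h i.succ (z.2 i) := by
      intro z
      rw [Fin.prod_univ_succ]
      simp [MeasurableEquiv.piFinSuccAbove, Fin.insertNthEquiv]
    simp_rw [this]
    rw [Measure.volume_eq_prod, lintegral_prod_mul (f := h 0)
      (g := fun y : Fin n → ℝ => ∏ i : Fin n, h i.succ (y i)) (hm 0).aemeasurable
      (Finset.measurable_prod _ fun i _ => (hm i.succ).comp (measurable_pi_apply i)).aemeasurable,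
      ih fun i => hm i.succ, Fin.prod_univ_succ]

theorem pi_withDensity_volume {n : ℕ} {h : Fin n → ℝ → ℝ≥0∞} (hm : ∀ i, Measurable (h i))
    [∀ i, SigmaFinite (volume.withDensity (h i))] :
    Measure.pi (fun i => volume.withDensity (h i))
      = (volume : Measure (Fin n → ℝ)).withDensity fun x => ∏ i, h i (x i) := by
  refine Measure.pi_eq fun s hs => ?_
  rw [withDensity_apply _ (MeasurableSet.univ_pi hs),
    ← lintegral_indicator (MeasurableSet.univ_pi hs)]
  have : ∀ x : Fin n → ℝ, (Set.univ.pi s).indicator (fun x => ∏ i, h i (x i)) x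
      = ∏ i, (s i).indicator (h i) (x i) := by
    intro x
    by_cases hx : x ∈ Set.univ.pi s
    · rw [Set.indicator_of_mem hx]
      exact Finset.prod_congr rfl fun i _ => (Set.indicator_of_mem (hx i trivial) _).symm
    · rw [Set.indicator_of_notMem hx]
      simp only [Set.mem_pi, not_forall] at hx
      obtain ⟨i, -, hi⟩ := hx
      exact (Finset.prod_eq_zero (Finset.mem_univ i) (Set.indicator_of_notMem hi _)).symm
  simp_rw [this]
  rw [lintegral_prod_eval_eq_prod_lintegral fun i => (hm i).indicator (hs i)]
  exact Finset.prod_congr rfl fun i _ => by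
    rw [withDensity_apply _ (hs i), lintegral_indicator (hs i)]

/-! ### Null sets on lines, on rays and under homogeneous functions -/

theorem ae_ae_update {n : ℕ} {P : (Fin n → ℝ) → Prop} (h : ∀ᵐ x, P x) (i : Fin n) :
    ∀ᵐ x : Fin n → ℝ, ∀ᵐ s : ℝ, P (Function.update x i s) := by
  obtain _ | n := n
  · exact i.elim0
  have hmp := volume_preserving_piFinSuccAbove (fun _ : Fin (n + 1) => ℝ) i
  have h1 := hmp.symm.quasiMeasurePreserving.ae h
  rw [Measure.volume_eq_prod] at h1
  have h2 := Measure.measurePreserving_swap.quasiMeasurePreserving.ae h1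
  have h3 := Measure.ae_ae_of_ae_prod h2
  have h4 := (Measure.quasiMeasurePreserving_snd.comp hmp.quasiMeasurePreserving).ae h3
  filter_upwards [h4] with x hx
  filter_upwards [hx] with s hs
  convert hs using 1
  simp [MeasurableEquiv.piFinSuccAbove, Fin.insertNthEquiv]

theorem ae_const_mul {P : ℝ → Prop} (h : ∀ᵐ r, P r) {c : ℝ} (hc : c ≠ 0) : ∀ᵐ s, P (c * s) := by
  have := Real.volume_preimage_mul_left hc {r | ¬ P r}
  rw [ae_iff] at h ⊢
  rw [h, mul_zero] at this
  exact this

theorem ae_const_smul {n : ℕ} {P : (Fin n → ℝ) → Prop} (h : ∀ᵐ x, P x) {c : ℝ} (hc : c ≠ 0) :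
    ∀ᵐ x, P (c • x) := by
  have := Measure.addHaar_preimage_smul (volume : Measure (Fin n → ℝ)) hc {r | ¬ P r}
  rw [ae_iff] at h ⊢
  rw [h, mul_zero] at this
  exact this

theorem ae_ae_smul {n : ℕ} {P : (Fin n → ℝ) → Prop} (h : ∀ᵐ x, P x) :
    ∀ᵐ x : Fin n → ℝ, ∀ᵐ s : ℝ, P (s • x) := by
  obtain ⟨S, hSP, hS, hSm⟩ := (show ∃ S : Set (Fin n → ℝ), (∀ x ∈ S, P x) ∧ (∀ᵐ x, x ∈ S) ∧
      MeasurableSet S from by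
    obtain ⟨N, hN, hNm, hN0⟩ := exists_measurable_superset_of_null (ae_iff.1 h)
    refine ⟨Nᶜ, fun x hx => by_contra fun hP => hx (hN hP), ?_, hNm.compl⟩
    rw [ae_iff]; simpa using hN0)
  have h1 : ∀ᵐ s : ℝ, ∀ᵐ x : Fin n → ℝ, s • x ∈ S := by
    filter_upwards [compl_mem_ae_iff.2 (measure_singleton (μ := (volume : Measure ℝ)) 0)] with s hs
    exact ae_const_smul hS hs
  have h2 := (Measure.ae_ae_comm (p := fun (s : ℝ) (x : Fin n → ℝ) => s • x ∈ S)
    (hSm.preimage (measurable_fst.smul measurable_snd))).1 h1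
  filter_upwards [h2] with x hx
  filter_upwards [hx] with s hs using hSP _ hs

theorem ae_eval_ne_zero {n : ℕ} (i : Fin n) : ∀ᵐ x : Fin n → ℝ, x i ≠ 0 := by
  have := (Measure.quasiMeasurePreserving_eval (fun _ : Fin n => (volume : Measure ℝ)) i).ae
    (compl_mem_ae_iff.2 (measure_singleton (μ := (volume : Measure ℝ)) 0))
  exact this

/-- A positively homogeneous function pulls null sets of radii back to null sets. -/
theorem ae_comp_of_homogeneous {n : ℕ} {f : (Fin n → ℝ) → ℝ} (hf : Measurable f)
    (hom : ∀ (s : ℝ) x, f (s • x) = |s| * f x) {i : Fin n} (hi : ∀ x, |x i| ≤ f x)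
    {P : ℝ → Prop} (h : ∀ᵐ r, P r) : ∀ᵐ x, P (f x) := by
  obtain ⟨N, hN, hNm, hN0⟩ := exists_measurable_superset_of_null (ae_iff.1 h)
  have hN' : ∀ᵐ r : ℝ, r ∉ N := by rw [ae_iff]; simpa using hN0
  have h1 : ∀ᵐ x : Fin n → ℝ, ∀ᵐ s : ℝ, f (s • x) ∉ N := by
    filter_upwards [ae_eval_ne_zero i] with x hx
    have hfx : 0 < f x := (abs_pos.2 hx).trans_le (hi x)
    filter_upwards [ae_const_mul hN' hfx.ne', ae_const_mul hN' (neg_ne_zero.2 hfx.ne')]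
      with s hs hs'
    rw [hom]
    rcases abs_choice s with h | h <;> rw [h]
    · rwa [mul_comm]
    · rwa [mul_comm, mul_neg, ← neg_mul]
  have h2 := (Measure.ae_ae_comm (p := fun (x : Fin n → ℝ) (s : ℝ) => f (s • x) ∉ N)
    (hNm.preimage (hf.comp (measurable_snd.smul measurable_fst))).compl).1 h1
  -- One good nonzero `s` suffices: the dilation by `s` is then undone.
  obtain ⟨s, hs, hs0⟩ := (h2.and
    (compl_mem_ae_iff.2 (measure_singleton (μ := (volume : Measure ℝ)) 0))).exists
  have hs0' : s ≠ 0 := hs0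
  filter_upwards [ae_const_smul hs (inv_ne_zero hs0')] with x hx
  rw [smul_inv_smul₀ hs0'] at hx
  exact by_contra fun hP => hx (hN hP)

/-- A continuous function which is almost everywhere a function of a homogeneous `f` is everywhere
a continuous function of `f`. -/
theorem exists_continuous_comp_of_ae_eq_comp {n : ℕ} {f H : (Fin n → ℝ) → ℝ} {g : ℝ → ℝ}
    (hf : Continuous f) (hom : ∀ (s : ℝ) x, f (s • x) = |s| * f x) {i : Fin n}
    (hi : ∀ x, |x i| ≤ f x) (hH : Continuous H) (h : ∀ᵐ x, g (f x) = H x) :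
    ∃ G : ℝ → ℝ, Continuous G ∧ ∀ x, H x = G (f x) := by
  -- On a generic ray the identity holds at almost every point; `G` is read off from `H` along this
  -- ray, parametrized by the value of `f`.
  obtain ⟨θ, hθ, hθ0⟩ := ((ae_ae_smul h).and (ae_eval_ne_zero i)).exists
  have hfθ : 0 < f θ := (abs_pos.2 hθ0).trans_le (hi θ)
  have hG : Continuous fun r : ℝ => H (((f θ)⁻¹ * r) • θ) :=
    hH.comp ((continuous_const.mul continuous_id).smul continuous_const)
  refine ⟨fun r => H (((f θ)⁻¹ * r) • θ), hG, ?_⟩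
  have h1 := ae_comp_of_homogeneous hf.measurable hom hi
    (ae_const_mul hθ (inv_ne_zero hfθ.ne'))
  have h2 : H =ᵐ[volume] fun x => H (((f θ)⁻¹ * f x) • θ) := by
    filter_upwards [h, h1] with x hx hx1
    have hfx : 0 ≤ f x := (abs_nonneg _).trans (hi x)
    rw [← hx, ← hx1, hom, abs_of_nonneg (by positivity), mul_comm, mul_inv_cancel_left₀ hfθ.ne']
  exact fun x => congrFun ((Continuous.ae_eq_iff_eq volume hH (hG.comp hf)).1 h2) x

/-! ### Continuous versions of the marginal densities -/

theorem exists_setIntegral_absIcc_ne_zero {h : ℝ → ℝ} (h0 : ∀ t, 0 ≤ h t) (hi : Integrable h)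
    (hne : ¬ ∀ᵐ t, h t = 0) : ∃ a b, 0 < a ∧ ∫ t in absIcc a b, h t ≠ 0 := by
  by_contra! hc
  refine hne ?_
  have h1 : ∀ m : ℕ, ∀ᵐ t, t ∈ absIcc (1 / ((m : ℝ) + 1)) m → h t = 0 := by
    intro m
    have h2 := hc (1 / ((m : ℝ) + 1)) m (by positivity)
    rw [setIntegral_eq_zero_iff_of_nonneg_ae (Filter.Eventually.of_forall h0)
      hi.integrableOn] at h2
    exact (ae_restrict_iff' (measurableSet_absIcc _ _)).1 h2
  filter_upwards [ae_all_iff.2 h1,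
    compl_mem_ae_iff.2 (measure_singleton (μ := (volume : Measure ℝ)) 0)] with t ht ht0
  have ht0' : 0 < |t| := abs_pos.2 ht0
  obtain ⟨m, hm⟩ := exists_nat_ge (max |t| (1 / |t|))
  refine ht m ⟨?_, (le_max_left _ _).trans hm⟩
  rw [one_div_le (by positivity) ht0']
  exact ((le_max_right _ _).trans hm).trans (by linarith)

theorem LpTree.NodesValid.exists_continuous_ae_eq_of_prod {n : ℕ} {T : LpTree (Fin n)}
    (hT : T.NodesValid) (hd : T.leaves.Nodup) {g : ℝ → ℝ} (hg : Measurable g)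
    (hgi : ∀ a M, 0 < a → IntegrableOn g (Set.Icc a M)) {h : Fin n → ℝ → ℝ}
    (h0 : ∀ k t, 0 ≤ h k t) (hi : ∀ k, Integrable (h k))
    (hne : ¬ ∀ᵐ x : Fin n → ℝ, ∏ k, h k (x k) = 0)
    (heq : ∀ᵐ x, g (T.nestedFun x) = ∏ k, h k (x k)) {i j : Fin n} (hij : i ≠ j)
    (hj : j ∈ T.leaves) :
    ∃ h' : ℝ → ℝ, Continuous h' ∧ h i =ᵐ[volume] h' := by
  have hjne : ¬ ∀ᵐ t, h j t = 0 := by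
    intro hz
    refine hne ?_
    filter_upwards [(Measure.quasiMeasurePreserving_eval
      (fun _ : Fin n => (volume : Measure ℝ)) j).ae hz] with x hx
    exact Finset.prod_eq_zero (Finset.mem_univ j) hx
  obtain ⟨a, b, ha, hK⟩ := exists_setIntegral_absIcc_ne_zero (h0 j) (hi j) hjne
  -- A base point with no vanishing factor, at which the identity holds for almost all replacements
  -- of coordinates `i` and `j`.
  obtain ⟨x, hxne, hx⟩ := ((Filter.not_eventually.1 hne).and_eventually
    (ae_ae_update (ae_ae_update heq j) i)).exists
  set C := ∏ k ∈ (Finset.univ.erase i).erase j, h k (x k)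
  have hjm : j ∈ Finset.univ.erase i := Finset.mem_erase.2 ⟨hij.symm, Finset.mem_univ j⟩
  have hC : C ≠ 0 := by
    refine Finset.prod_ne_zero_iff.2 fun k _ => ?_
    exact Finset.prod_ne_zero_iff.1 hxne k (Finset.mem_univ k)
  have hprod : ∀ s t, ∏ k, h k (Function.update (Function.update x i s) j t k)
      = h i s * C * h j t := by
    intro s t
    rw [← Finset.mul_prod_erase _ _ (Finset.mem_univ i), ← Finset.mul_prod_erase _ _ hjm]
    have : ∏ k ∈ (Finset.univ.erase i).erase j,
        h k (Function.update (Function.update x i s) j t k) = C := by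
      refine Finset.prod_congr rfl fun k hk => ?_
      simp only [Finset.mem_erase] at hk
      rw [Function.update_of_ne hk.1, Function.update_of_ne hk.2.1]
    rw [this, Function.update_self, Function.update_of_ne hij, Function.update_self]
    ring
  have hcont : Continuous fun s =>
      ∫ u in absIcc a b, g (T.nestedFun (Function.update (Function.update x i s) j u)) := by
    refine continuous_setIntegral_absIcc_comp (F := fun s u =>
      T.nestedFun (Function.update (Function.update x i s) j u)) ?_ ?_ ?_ ?_ hg
      fun M => hgi a M ha
    · have hu : Continuous fun z : ℝ × ℝ => Function.update (Function.update x i z.1) j z.2 :=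
        ((continuous_const : Continuous fun _ : ℝ × ℝ => x).update i continuous_fst).update j
          continuous_snd
      exact hT.continuous_nestedFun.comp hu
    · intro s u
      refine LpTree.nestedFun_congr T fun k _ => ?_
      by_cases hk : k = j
      · subst hk; simp
      · simp [hk]
    · intro s u hu
      have := hT.abs_le_nestedFun (Function.update (Function.update x i s) j u) hj
      rw [Function.update_self] at this
      exact hu.1.trans ((le_abs_self u).trans this)
    · intro B
      obtain ⟨c, hc, hexp⟩ := hT.exists_mul_sub_le_nestedFun_sub hd hj ha (max b (max B ‖x‖))
      refine ⟨c, hc, fun s hs u v hu huv hv => hexp _ (fun k => ?_) u v hu huv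
        (hv.trans (le_max_left _ _))⟩
      by_cases hk : k = i
      · subst hk
        rw [Function.update_self]
        exact hs.trans ((le_max_left _ _).trans (le_max_right _ _))
      · rw [Function.update_of_ne hk]
        exact (norm_le_pi_norm x k).trans ((le_max_right _ _).trans (le_max_right _ _))
  refine ⟨_, hcont.div_const (C * ∫ t in absIcc a b, h j t), ?_⟩
  filter_upwards [hx] with s hs
  have : ∫ u in absIcc a b, g (T.nestedFun (Function.update (Function.update x i s) j u))
      = ∫ u in absIcc a b, h i s * C * h j u := by
    refine integral_congr_ae (ae_restrict_of_ae ?_)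
    filter_upwards [hs] with t ht
    rw [ht, hprod]
  rw [this, integral_const_mul, mul_assoc, mul_div_cancel_right₀]
  exact mul_ne_zero hC hK

/-! ### Cauchy's functional equation on the half-line -/

/-- The odd extension from the half-line is additive on the whole line, and continuous additive maps
are linear. -/
theorem eq_const_mul_of_continuous_of_add_on_nonneg {L : ℝ → ℝ} (hL : Continuous L)
    (hadd : ∀ u v, 0 ≤ u → 0 ≤ v → L (u + v) = L u + L v) :
    ∃ c, ∀ u, 0 ≤ u → L u = c * u := by
  have h0 : L 0 = 0 := by simpa using hadd 0 0 le_rfl le_rfl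
  have hA : ∀ u v : ℝ, L (max (u + v) 0) - L (max (-(u + v)) 0)
      = (L (max u 0) - L (max (-u) 0)) + (L (max v 0) - L (max (-v) 0)) := by
    intro u v
    have hm : ∀ w : ℝ, max w 0 - max (-w) 0 = w := fun w => max_zero_sub_max_neg_zero_eq_self w
    have hle : ∀ w : ℝ, 0 ≤ max w 0 := fun w => le_max_right _ _
    have e : max u 0 + max v 0 + max (-(u + v)) 0 = max (-u) 0 + max (-v) 0 + max (u + v) 0 := by
      linarith [hm u, hm v, hm (u + v)]
    have := congrArg L e
    rw [hadd _ _ (add_nonneg (hle _) (hle _)) (hle _), hadd _ _ (hle _) (hle _),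
      hadd _ _ (add_nonneg (hle _) (hle _)) (hle _), hadd _ _ (hle _) (hle _)] at this
    linarith
  let A : ℝ →+ ℝ := AddMonoidHom.mk' (fun u => L (max u 0) - L (max (-u) 0)) hA
  have hAc : Continuous A := by
    change Continuous fun u => L (max u 0) - L (max (-u) 0)
    fun_prop
  refine ⟨A 1, fun u hu => ?_⟩
  have h1 := map_real_smul A hAc u 1
  have h2 : A u = L u := by
    change L (max u 0) - L (max (-u) 0) = L u
    rw [max_eq_left hu, max_eq_right (neg_nonpos.2 hu), h0, sub_zero]
  rw [smul_eq_mul, mul_one, h2, smul_eq_mul, mul_comm] at h1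
  exact h1

/-- A zero would pass to `u / 2 ^ k` for all `k`, against continuity and `m 0 = 1`; so the logarithm
is defined and additive. -/
theorem eq_exp_of_continuous_of_map_add_eq_mul_on_nonneg {m : ℝ → ℝ} (hm : Continuous m)
    (h0 : m 0 = 1) (hmul : ∀ u v, 0 ≤ u → 0 ≤ v → m (u + v) = m u * m v) :
    ∃ c, ∀ u, 0 ≤ u → m u = Real.exp (c * u) := by
  have hsq : ∀ u, 0 ≤ u → m u = m (u / 2) * m (u / 2) := fun u hu => by
    rw [← hmul _ _ (by positivity) (by positivity), add_halves]
  have hpos : ∀ u, 0 ≤ u → 0 < m u := by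
    intro u hu
    refine lt_of_le_of_ne (by rw [hsq u hu]; exact mul_self_nonneg _) fun hz => ?_
    have hk : ∀ k : ℕ, m (u / 2 ^ k) = 0 := by
      intro k
      induction k with
      | zero => simpa using hz.symm
      | succ k ih =>
        rw [hsq _ (by positivity), mul_self_eq_zero] at ih
        rw [pow_succ, ← div_div]
        exact ih
    have hlim : Filter.Tendsto (fun k : ℕ => u / 2 ^ k) Filter.atTop (nhds 0) :=
      Filter.Tendsto.const_div_atTop (tendsto_pow_atTop_atTop_of_one_lt one_lt_two) u
    have h1 := (hm.tendsto 0).comp hlim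
    have h2 : m ∘ (fun k : ℕ => u / 2 ^ k) = fun _ => 0 := funext hk
    rw [h2, h0] at h1
    exact zero_ne_one (tendsto_nhds_unique tendsto_const_nhds h1)
  obtain ⟨c, hc⟩ := eq_const_mul_of_continuous_of_add_on_nonneg
    (L := fun u => Real.log (m |u|))
    ((hm.comp continuous_abs).log fun u => (hpos _ (abs_nonneg u)).ne')
    (fun u v hu hv => by
      rw [abs_of_nonneg hu, abs_of_nonneg hv, abs_of_nonneg (add_nonneg hu hv), hmul u v hu hv,
        Real.log_mul (hpos u hu).ne' (hpos v hv).ne'])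
  refine ⟨c, fun u hu => ?_⟩
  rw [← hc u hu, abs_of_nonneg hu, Real.exp_log (hpos u hu)]

theorem eq_mul_exp_rpow_of_pair_equation {G : ℝ → ℝ} {q : ℝ} (hG : Continuous G) (hq : 0 < q)
    (h0 : G 0 ≠ 0)
    (h : ∀ x y, 0 ≤ x → 0 ≤ y → G ((x ^ q + y ^ q) ^ (1 / q)) * G 0 = G x * G y) :
    ∃ τ, ∀ r, 0 ≤ r → G r = G 0 * Real.exp (-τ * r ^ q) := by
  have hq' : 0 < 1 / q := by positivity
  obtain ⟨c, hc⟩ := eq_exp_of_continuous_of_map_add_eq_mul_on_nonneg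
    (m := fun u => G (u ^ (1 / q)) / G 0)
    ((hG.comp (Real.continuous_rpow_const hq'.le)).div_const _)
    (by rw [Real.zero_rpow hq'.ne', div_self h0])
    (fun u v hu hv => by
      have := h (u ^ (1 / q)) (v ^ (1 / q)) (Real.rpow_nonneg hu _) (Real.rpow_nonneg hv _)
      simp only [one_div, Real.rpow_inv_rpow hu hq.ne', Real.rpow_inv_rpow hv hq.ne'] at this ⊢
      field_simp
      simpa only [one_div] using this)
  refine ⟨-c, fun r hr => ?_⟩
  rw [neg_neg, ← hc _ (Real.rpow_nonneg hr q), one_div, Real.rpow_rpow_inv hr hq.ne',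
    mul_div_cancel₀ _ h0]

/-! ### Collapse of the tree and the main theorem -/

theorem LpTree.NodesValid.collapses_of_prod_eq_comp {n : ℕ} (hn : 2 ≤ n) {T : LpTree (Fin n)}
    (hT : T.NodesValid) (hl : T.leaves = (Finset.univ : Finset (Fin n)).val)
    {h : Fin n → ℝ → ℝ} {G : ℝ → ℝ} (hG : Continuous G)
    (heq : ∀ x : Fin n → ℝ, ∏ k, h k (x k) = G (T.nestedFun x))
    (hfin : ∫⁻ x : Fin n → ℝ, ENNReal.ofReal (G (T.nestedFun x)) = 1) :
    ∃ p τ, 0 < p ∧ 0 < τ ∧ T.CollapsesTo p ∧ (∀ x, T.nestedFun x = lpNormFun p x) ∧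
      0 < G 0 ∧ ∀ r, 0 ≤ r → G r = G 0 * Real.exp (-τ * r ^ p) := by
  have hmem : ∀ i, i ∈ T.leaves := fun i => by rw [hl]; exact Finset.mem_univ i
  have hd : T.leaves.Nodup := by rw [hl]; exact Finset.univ.nodup
  have haxis : ∀ i r, 0 ≤ r → T.nestedFun (Function.update 0 i r) = r := by
    intro i r hr
    rw [hT.nestedFun_eq_abs hd (hmem i) fun k _ hk => by rw [Function.update_of_ne hk]; rfl,
      Function.update_self, abs_of_nonneg hr]
  have hzero : T.nestedFun 0 = 0 := hT.nestedFun_eq_zero fun _ _ => rfl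
  have hGne : ∃ x, G (T.nestedFun x) ≠ 0 := by
    by_contra! hc
    simp [hc] at hfin
  have hG0 : G 0 ≠ 0 := by
    obtain ⟨x, hx⟩ := hGne
    have hG0' : G 0 = ∏ k, h k ((0 : Fin n → ℝ) k) := by rw [heq, hzero]
    rw [hG0']
    refine Finset.prod_ne_zero_iff.2 fun k _ => ?_
    have : Nontrivial (Fin n) := Fin.nontrivial_iff_two_le.2 hn
    obtain ⟨i, hik⟩ := exists_ne k
    -- A radius where `G` is nonzero is realized on the axis of some `i ≠ k`, where coordinate `k`
    -- is zero; hence `h k 0 ≠ 0`.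
    rw [← haxis i _ (LpTree.nestedFun_nonneg T x), ← heq] at hx
    have h1 := Finset.prod_ne_zero_iff.1 hx k (Finset.mem_univ k)
    rwa [Function.update_of_ne hik.symm] at h1
  have hpair : ∀ i k, i ≠ k → ∀ q, 0 < q → T.PairExponent i k q →
      ∃ τ, ∀ r, 0 ≤ r → G r = G 0 * Real.exp (-τ * r ^ q) := by
    intro i k hik q hq hP
    refine eq_mul_exp_rpow_of_pair_equation hG hq hG0 fun x y hx hy => ?_
    have h1 := hP (Function.update (Function.update 0 i x) k y) fun m hmi hmk => by
      rw [Function.update_of_ne hmk, Function.update_of_ne hmi]; rfl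
    rw [Function.update_self, Function.update_of_ne hik, Function.update_self, abs_of_nonneg hx,
      abs_of_nonneg hy] at h1
    have hGr : ∀ m r, 0 ≤ r → G r = ∏ l, h l ((Function.update 0 m r : Fin n → ℝ) l) :=
      fun m r hr => by rw [heq, haxis _ _ hr]
    rw [← h1, hGr i x hx, hGr k y hy, ← heq, ← hzero, ← heq, ← Finset.prod_mul_distrib,
      ← Finset.prod_mul_distrib]
    -- Both sides have the same factors at each coordinate, up to order: the point and the origin on
    -- one side, its two axis projections on the other.
    refine Finset.prod_congr rfl fun m _ => ?_
    by_cases hmk : m = k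
    · subst hmk
      simp [Function.update_of_ne hik.symm, mul_comm]
    · by_cases hmi : m = i
      · subst hmi
        simp [hmk]
      · simp [hmk, hmi]
  have hτ : ∀ q τ : ℝ, (∀ r, 0 ≤ r → G r = G 0 * Real.exp (-τ * r ^ q)) → 0 < G 0 ∧ 0 < τ := by
    intro q τ hr
    have hpos : 0 < G 0 := by
      by_contra hneg
      obtain ⟨x, hx⟩ : ∃ x, 0 < G (T.nestedFun x) := by
        by_contra! hc
        simp [ENNReal.ofReal_of_nonpos (hc _)] at hfin
      rw [hr _ (LpTree.nestedFun_nonneg T x)] at hx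
      exact absurd hx (not_lt.2 (mul_nonpos_of_nonpos_of_nonneg (not_lt.1 hneg)
        (Real.exp_pos _).le))
    refine ⟨hpos, ?_⟩
    by_contra hτ
    -- For `τ ≤ 0` the density would be at least `G 0 > 0` on a space of infinite volume.
    have hge : ∀ x : Fin n → ℝ, ENNReal.ofReal (G 0) ≤ ENNReal.ofReal (G (T.nestedFun x)) := by
      intro x
      refine ENNReal.ofReal_le_ofReal ?_
      have hf := LpTree.nestedFun_nonneg T x
      rw [hr _ hf]
      refine le_mul_of_one_le_right hpos.le (Real.one_le_exp ?_)
      exact mul_nonneg (neg_nonneg.2 (not_lt.1 hτ)) (Real.rpow_nonneg hf _)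
    have hint := lintegral_mono (μ := (volume : Measure (Fin n → ℝ))) hge
    have : Nonempty (Fin n) := ⟨⟨0, by omega⟩⟩
    rw [hfin, lintegral_const, measure_univ_of_isAddLeftInvariant, ENNReal.mul_top
      (by simpa using hpos)] at hint
    simp at hint
  have hne : (⟨0, by omega⟩ : Fin n) ≠ ⟨1, by omega⟩ := by simp
  obtain ⟨p, hp, hP⟩ := hT.exists_pairExponent hd hne (hmem _) (hmem _)
  obtain ⟨τ, hpτ⟩ := hpair _ _ hne p hp hP
  obtain ⟨hpos, hτp⟩ := hτ p τ hpτ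
  have hcol : T.CollapsesTo p := by
    refine hT.collapsesTo hd fun i _ k _ hik q hq hQ => ?_
    obtain ⟨σ, hσ⟩ := hpair i k hik q hq hQ
    have hcmp : ∀ r : ℝ, 0 ≤ r → σ * r ^ q = τ * r ^ p := by
      intro r hr
      have := (hσ r hr).symm.trans (hpτ r hr)
      have := Real.exp_injective (mul_left_cancel₀ hG0 this)
      linarith
    -- Radius 1 identifies the rates, radius 2 then the exponents.
    have h1 := hcmp 1 zero_le_one
    simp only [Real.one_rpow, mul_one] at h1
    have h2 := hcmp 2 zero_le_two
    rw [h1] at h2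
    have h3 := mul_left_cancel₀ hτp.ne' h2
    exact (Real.strictMono_rpow_of_base_gt_one one_lt_two).injective h3
  refine ⟨p, τ, hp, hτp, hcol, fun x => ?_, hpos, hpτ⟩
  rw [hT.nestedFun_eq_of_collapsesTo hp hcol, hl, lpNormFun]
  rfl

theorem proposition5 {Ω : Type*} [MeasurableSpace Ω] (P : Measure Ω) [IsProbabilityMeasure P]
    (n : ℕ) (hn : 2 ≤ n) (X : Ω → Fin n → ℝ) (hX : AEMeasurable X P)
    (T : LpTree (Fin n)) (hsymm : IsLpNestedSymmetric T (P.map X))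
    (hindep : iIndepFun (fun (i : Fin n) (ω : Ω) => X ω i) P) :
    ∃ p : ℝ, 0 < p ∧ T.CollapsesTo p ∧ (∀ x : Fin n → ℝ, T.nestedFun x = lpNormFun p x) ∧
      IsLpSphericallySymmetric p (P.map X) ∧ IsPGeneralizedNormal p (P.map X) := by
  obtain ⟨⟨hT, hl⟩, hss⟩ := hsymm
  obtain ⟨ϱ, ⟨hϱm, hϱ0, hϱ1⟩, hμ⟩ := id hss
  have : IsProbabilityMeasure (P.map X) := Measure.isProbabilityMeasure_map hX
  have hmem : ∀ i, i ∈ T.leaves := fun i => by rw [hl]; exact Finset.mem_univ i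
  have hd : T.leaves.Nodup := by rw [hl]; exact Finset.univ.nodup
  set S := sphereSurface T.nestedFun 1
  let g : ℝ → ℝ := fun r => ϱ r / (r ^ (n - 1) * S)
  have hg : Measurable g := hϱm.div ((measurable_id.pow_const _).mul_const _)
  have hfm : Measurable T.nestedFun := hT.continuous_nestedFun.measurable
  have hmass : ∫⁻ x : Fin n → ℝ, ENNReal.ofReal (g (T.nestedFun x)) = 1 := by
    have : (P.map X) Set.univ = 1 := measure_univ
    rwa [hμ, withDensity_apply _ MeasurableSet.univ, Measure.restrict_univ] at this
  -- Positivity of the surface constant needs no volume computation: otherwise the density would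
  -- vanish, against total mass 1.
  have hS : 0 < S := by
    by_contra hS
    have : ∀ x : Fin n → ℝ, ENNReal.ofReal (g (T.nestedFun x)) = 0 := fun x =>
      ENNReal.ofReal_of_nonpos (div_nonpos_of_nonneg_of_nonpos (hϱ0 _)
        (mul_nonpos_of_nonneg_of_nonpos (pow_nonneg (LpTree.nestedFun_nonneg T x) _)
          (not_lt.1 hS)))
    simp [this] at hmass
  have hg0 : ∀ x, 0 ≤ g (T.nestedFun x) := fun x =>
    div_nonneg (hϱ0 _) (mul_nonneg (pow_nonneg (LpTree.nestedFun_nonneg T x) _) hS.le)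
  -- Only away from 0, where the factor `r ^ (n - 1)` in the denominator is harmless.
  have hgi : ∀ a M, 0 < a → IntegrableOn g (Set.Icc a M) := by
    intro a M ha
    have h1 : IntegrableOn ϱ (Set.Ioi 0) := by
      refine ⟨hϱm.aestronglyMeasurable, ?_⟩
      rw [hasFiniteIntegral_iff_ofReal (Filter.Eventually.of_forall hϱ0), hϱ1]
      exact ENNReal.one_lt_top
    have h2 : IntegrableOn ϱ (Set.Icc a M) := h1.mono_set fun r hr => ha.trans_le hr.1
    have h3 : ContinuousOn (fun r : ℝ => (r ^ (n - 1) * S)⁻¹) (Set.Icc a M) := by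
      refine ContinuousOn.inv₀ (by fun_prop) fun r hr => ?_
      have := ha.trans_le hr.1
      positivity
    simpa only [g, div_eq_mul_inv] using h2.mul_continuousOn h3 isCompact_Icc
  have hXi : ∀ i, AEMeasurable (fun ω => X ω i) P := fun i =>
    (measurable_pi_apply i).comp_aemeasurable hX
  have hpi : P.map X = Measure.pi fun i => P.map fun ω => X ω i :=
    (iIndepFun_iff_map_fun_eq_pi_map hXi).1 hindep
  have hprob : ∀ i, IsProbabilityMeasure (P.map fun ω => X ω i) := fun i =>
    Measure.isProbabilityMeasure_map (hXi i)
  have hac : ∀ i, (P.map fun ω => X ω i) ≪ (volume : Measure ℝ) := by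
    intro i
    have h1 : (P.map fun ω => X ω i) = (P.map X).map (Function.eval i) :=
      (AEMeasurable.map_map_of_aemeasurable (measurable_pi_apply i).aemeasurable hX).symm
    rw [h1]
    have h2 : P.map X ≪ volume := hμ ▸ withDensity_absolutelyContinuous _ _
    exact (h2.map (measurable_pi_apply i)).trans (Measure.quasiMeasurePreserving_eval
      (fun _ : Fin n => (volume : Measure ℝ)) i).absolutelyContinuous
  let k : Fin n → ℝ → ℝ≥0∞ := fun i => (P.map fun ω => X ω i).rnDeriv volume
  have hk : ∀ i, Measurable (k i) := fun i => Measure.measurable_rnDeriv _ _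
  have hkd : ∀ i, volume.withDensity (k i) = P.map fun ω => X ω i := fun i =>
    Measure.withDensity_rnDeriv_eq _ _ (hac i)
  have hσ : ∀ i, SigmaFinite (volume.withDensity (k i)) := fun i => by rw [hkd]; infer_instance
  have hdens : (fun x : Fin n → ℝ => ENNReal.ofReal (g (T.nestedFun x)))
      =ᵐ[volume] fun x => ∏ i, k i (x i) := by
    refine (withDensity_eq_iff
      (f := fun x : Fin n → ℝ => ENNReal.ofReal (g (T.nestedFun x)))
      (g := fun x : Fin n → ℝ => ∏ i, k i (x i)) (hg.comp hfm).ennreal_ofReal.aemeasurable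
      (Finset.measurable_prod _ fun i _ => (hk i).comp (measurable_pi_apply i)).aemeasurable
      (by rw [hmass]; exact ENNReal.one_ne_top)).1 ?_
    rw [← pi_withDensity_volume hk]
    simp_rw [hkd]
    rw [← hpi, hμ]
  let h : Fin n → ℝ → ℝ := fun i t => (k i t).toReal
  have heq : ∀ᵐ x : Fin n → ℝ, g (T.nestedFun x) = ∏ i, h i (x i) := by
    filter_upwards [hdens] with x hx
    rw [← ENNReal.toReal_ofReal (hg0 x), hx, ENNReal.toReal_prod]
  have hi : ∀ i, Integrable (h i) := fun i => by
    refine integrable_toReal_of_lintegral_ne_top (hk i).aemeasurable ?_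
    rw [← setLIntegral_univ, ← withDensity_apply _ MeasurableSet.univ, hkd]
    exact measure_ne_top _ _
  have hne : ¬ ∀ᵐ x : Fin n → ℝ, ∏ i, h i (x i) = 0 := by
    intro hz
    have : (fun x : Fin n → ℝ => ENNReal.ofReal (g (T.nestedFun x))) =ᵐ[volume] 0 := by
      filter_upwards [hz, heq] with x h1 h2
      simp [h2, h1]
    rw [lintegral_congr_ae this] at hmass
    simp at hmass
  have hcont : ∀ i, ∃ h' : ℝ → ℝ, Continuous h' ∧ h i =ᵐ[volume] h' := by
    intro i
    have : Nontrivial (Fin n) := Fin.nontrivial_iff_two_le.2 hn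
    obtain ⟨j, hj⟩ := exists_ne i
    exact hT.exists_continuous_ae_eq_of_prod hd hg hgi (fun _ _ => ENNReal.toReal_nonneg) hi hne
      heq hj.symm (hmem j)
  choose h' hc' hh' using hcont
  have heq' : ∀ᵐ x : Fin n → ℝ, g (T.nestedFun x) = ∏ i, h' i (x i) := by
    have : ∀ᵐ x : Fin n → ℝ, ∀ i, h i (x i) = h' i (x i) := ae_all_iff.2 fun i =>
      (Measure.quasiMeasurePreserving_eval (fun _ : Fin n => (volume : Measure ℝ)) i).ae (hh' i)
    filter_upwards [heq, this] with x h1 h2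
    rw [h1]
    exact Finset.prod_congr rfl fun i _ => h2 i
  obtain ⟨G, hGc, hG⟩ := exists_continuous_comp_of_ae_eq_comp
    (H := fun x : Fin n → ℝ => ∏ i, h' i (x i)) hT.continuous_nestedFun
    hT.nestedFun_smul (i := ⟨0, by omega⟩) (fun x => hT.abs_le_nestedFun x (hmem _))
    (continuous_finsetProd _ fun i _ => (hc' i).comp (continuous_apply i)) heq'
  have hgG : ∀ᵐ x : Fin n → ℝ,
      ENNReal.ofReal (g (T.nestedFun x)) = ENNReal.ofReal (G (T.nestedFun x)) := by
    filter_upwards [heq'] with x hx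
    rw [hx, ← hG]
  obtain ⟨p, τ, hp, hτ, hcol, hf, hpos, hexp⟩ := hT.collapses_of_prod_eq_comp hn hl hGc hG
    (by rw [← lintegral_congr_ae hgG, hmass])
  have hff : T.nestedFun = lpNormFun p := funext hf
  refine ⟨p, hp, hcol, hf, ⟨hp, hff ▸ hss⟩, hp, τ, hτ, ?_⟩
  have hGx : ∀ x : Fin n → ℝ,
      G (T.nestedFun x) = G 0 * Real.exp (-τ * lpNormFun p x ^ p) := fun x => by
    rw [hexp _ (LpTree.nestedFun_nonneg T x), hf]
  -- Total mass 1 identifies `G 0` as the reciprocal of the normalizing integral.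
  have hint : G 0 * ∫ y : Fin n → ℝ, Real.exp (-τ * lpNormFun p y ^ p) = 1 := by
    rw [← integral_const_mul]
    simp_rw [← hGx]
    rw [integral_eq_lintegral_of_nonneg_ae, ← lintegral_congr_ae hgG, hmass, ENNReal.toReal_one]
    · exact Filter.Eventually.of_forall fun x => by
        simp only [hGx]; exact mul_nonneg hpos.le (Real.exp_pos _).le
    · exact (hGc.comp hT.continuous_nestedFun).aestronglyMeasurable
  rw [hμ]
  refine withDensity_congr_ae ?_
  filter_upwards [hgG] with x hx
  refine hx.trans ?_
  rw [hGx, eq_div_of_mul_eq (right_ne_zero_of_mul_eq_one hint) hint, one_div_mul_eq_div]
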